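/- All digraphs are finite and simple (no self-loops, no multiple edges). **Directed minors.** A digraph $H$ is a *directed minor* of a digraph $G$ if $H$ is isomorphic to a digraph obtained from $G$ by a finite sequence, in any order, of the following operations, where resulting self-loops and multiple edges are removed: deleting a vertex; deleting an edge; *contracting a directed cycle* (replacing its vertex set $C$ by one new vertex $w$, with an edge $(x,w)$, respectively $(w,x)$, for every $x\notin C$ that has an edge to, respectively from, some vertex of $C$); *out-contracting* an edge $(u,v)$ (adding an edge $(x,v)$ for every edge $(x,u)$ and then deleting $u$); *in-contracting* an edge $(u,v)$ (adding an edge $(u,x)$ for every edge $(v,x)$ and then deleting $v$). **Partial $k$-DAGs.** The class of $k$-DAGs is defined recursively: a complete digraph on $k$ vertices is a $k$-DAG; and if $H$ is a $k$-DAG, so is every digraph obtained from $H$ by adding a new vertex $v$, edges from $v$ to the vertices of a set $X\subseteq V(H)$ with $|X|\le k$, and an edge $(u,v)$ for exactly those $u\in V(H)$ with $(u,w)\in E(H)$ for all $w\in X\setminus\{u\}$. A *partial $k$-DAG* is a digraph isomorphic to a subgraph of a $k$-DAG. **Kelly-width.** A set $X\subseteq V(G)$ *guards* $W\subseteq V(G)$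 if $W\cap X=\emptyset$ and every edge of $G$ with tail in $W$ has its head in $W\cup X$. A *Kelly-decomposition* of $G$ consists of a finite DAG $T$ and families $(W_i)_{i\in V(T)}$, $(X_i)_{i\in V(T)}$ of subsets of $V(G)$ such that, writing $W_{\succeq i}$ for the union of the $W_j$ over all nodes $j$ reachable from $i$ in $T$ (including $i$): (1) the $W_i$ form a partition of $V(G)$; (2) $X_i$ guards $W_{\succeq i}$ for every node $i$; (3) for every node $i$ the children of $i$ can be enumerated as $j_1,\dots,j_s$ so that $X_{j_q}\subseteq W_i\cup X_i\cup\bigcup_{p<q}W_{\succeq j_p}$ for each $q$, and the roots of $T$ can be enumerated as $r_1,r_2,\dots$ so that $X_{r_q}\subseteq\bigcup_{p<q}W_{\succeq r_p}$ for each $q$. Its width is $\max_i|W_i\cup X_i|$, and the *Kelly-width* of $G$ is the minimum width of a Kelly-decomposition of $G$. **The three digraphs.** $K_3$ is the complete digraph on three vertices (all six edges). $N_4$ has vertices $0,1,2,3$ and the edges $(i,i+1),(i+1,i)$ for $0\le i\le 2$, together with $(0,2)$ and $(3,1)$. $M_5$ has vertices $0,1,2,3,4$ and the edges $(i,i+1),(i+1,i)$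 for $0\le i\le 3$, together with $(0,2)$ and $(4,2)$. **Theorem.** Let $G$ be a digraph. Then $G$ has Kelly-width at most $2$ if and only if $G$ is a partial $1$-DAG, and $G$ is a partial $1$-DAG if and only if none of $K_3$, $N_4$, $M_5$ is a directed minor of $G$. -/

import Mathlib

universe u

namespace Digraph

/-- No self-loops. Multiple edges are impossible since the edges are given by a relation. -/
def Loopless {V : Type u} (G : Digraph V) : Prop := ∀ v, ¬ G.Adj v v

/-! ### Directed minor operations -/

/-- Delete the vertex `v`. -/
def deleteVertex {V : Type u} (G : Digraph V) (v : V) : Digraph {x : V // x ≠ v} where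
  Adj x y := G.Adj x y

/-- Delete the edge `(u, v)`. -/
def deleteEdge {V : Type u} (G : Digraph V) (u v : V) : Digraph V where
  Adj x y := G.Adj x y ∧ ¬ (x = u ∧ y = v)

/-- Out-contract `(u, v)`: the tail `u` disappears, its in-neighbours now point to `v`, the other
edges at `u` are lost, and a resulting loop is removed. -/
def outContract {V : Type u} (G : Digraph V) (u v : V) : Digraph {x : V // x ≠ u} where
  Adj x y := x ≠ y ∧ (G.Adj x y ∨ ((y : V) = v ∧ G.Adj x u))

/-- In-contract `(u, v)`: the head `v` disappears, its out-neighbours become out-neighbours of `u`,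
the other edges at `v` are lost, and a resulting loop is removed. -/
def inContract {V : Type u} (G : Digraph V) (u v : V) : Digraph {x : V // x ≠ v} where
  Adj x y := x ≠ y ∧ (G.Adj x y ∨ ((x : V) = u ∧ G.Adj v y))

/-- Contract the vertex set `C` to one new vertex, which is `none`. -/
def contractSet {V : Type u} (G : Digraph V) (C : Set V) : Digraph (Option {x : V // x ∉ C}) where
  Adj
    | some x, some y => G.Adj x y
    | some x, none => ∃ c ∈ C, G.Adj x c
    | none, some y => ∃ c ∈ C, G.Adj c y
    | none, none => False

/-- `c` lists the vertices of a directed cycle of length `n + 2` (the addition in `Fin (n + 2)` is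
cyclic). A loopless digraph has no cycle of length `1`. -/
def IsDirectedCycle {V : Type u} (G : Digraph V) {n : ℕ} (c : Fin (n + 2) → V) : Prop :=
  Function.Injective c ∧ ∀ i, G.Adj (c i) (c (i + 1))

/-- `G.ReducesTo H`: the digraph `H` is obtained from `G` by a finite sequence of vertex deletions,
edge deletions, cycle contractions, out-contractions and in-contractions. -/
inductive ReducesTo {V : Type u} (G : Digraph V) : {W : Type u} → Digraph W → Prop
  | refl : ReducesTo G G
  | deleteVertex {W : Type u} {H : Digraph W} (h : ReducesTo G H) (v : W) :
      ReducesTo G (H.deleteVertex v)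
  | deleteEdge {W : Type u} {H : Digraph W} (h : ReducesTo G H) (u v : W) (huv : H.Adj u v) :
      ReducesTo G (H.deleteEdge u v)
  | contractCycle {W : Type u} {H : Digraph W} (h : ReducesTo G H) {n : ℕ} (c : Fin (n + 2) → W)
      (hc : H.IsDirectedCycle c) : ReducesTo G (H.contractSet (Set.range c))
  | outContract {W : Type u} {H : Digraph W} (h : ReducesTo G H) (u v : W) (huv : H.Adj u v) :
      ReducesTo G (H.outContract u v)
  | inContract {W : Type u} {H : Digraph W} (h : ReducesTo G H) (u v : W) (huv : H.Adj u v) :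
      ReducesTo G (H.inContract u v)

/-- `H` is a directed minor of `G`: it is isomorphic to a digraph that is obtained from `G` by a
sequence of directed minor operations. -/
def IsDirectedMinor {U : Type*} {V : Type u} (H : Digraph U) (G : Digraph V) : Prop :=
  ∃ (W : Type u) (G' : Digraph W), G.ReducesTo G' ∧ Nonempty (H.Adj ≃r G'.Adj)

/-! ### Partial `k`-DAGs -/

/-- The class of `k`-DAGs. In `extend`, the digraph `G` arises from the `k`-DAG `G - v` by adding
the vertex `v`, at most `k` edges from `v` to `G - v`, and all the edges `(u, v)` for which `(u, w)`
is an edge for every out-neighbour `w ≠ u` of `v`. -/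
inductive IsKDAG (k : ℕ) : {V : Type u} → Digraph V → Prop
  | complete {V : Type u} (G : Digraph V) (hfin : Finite V) (hcard : Nat.card V = k)
      (hG : ∀ x y, G.Adj x y ↔ x ≠ y) : IsKDAG k G
  | extend {V : Type u} (G : Digraph V) (v : V) (hH : IsKDAG k (G.deleteVertex v))
      (hloop : ¬ G.Adj v v) (hout : {w | G.Adj v w}.ncard ≤ k)
      (hin : ∀ u, u ≠ v → (G.Adj u v ↔ ∀ w, G.Adj v w → w ≠ u → G.Adj u w)) : IsKDAG k G

/-- A partial `k`-DAG is (up to isomorphism) a subgraph of a `k`-DAG. -/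
def IsPartialKDAG {V : Type u} (k : ℕ) (G : Digraph V) : Prop :=
  ∃ (W : Type u) (H : Digraph W), IsKDAG k H ∧
    ∃ f : V → W, Function.Injective f ∧ ∀ x y, G.Adj x y → H.Adj (f x) (f y)

/-! ### Kelly-width -/

/-- `X` guards `W`. -/
def Guards {V : Type u} (G : Digraph V) (X W : Set V) : Prop :=
  Disjoint W X ∧ ∀ x y, G.Adj x y → x ∈ W → y ∈ W ∪ X

/-- The union of the bags `W j` over all the nodes `j` that are reachable from `i` in `T`, `i`
included. -/
def bagsFrom {V : Type u} {N : Type} (T : Digraph N) (W : N → Set V) (i : N) : Set V :=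
  ⋃ j ∈ {j | Relation.ReflTransGen T.Adj i j}, W j

/-- A Kelly-decomposition of `G`. -/
structure KellyDecomposition {V : Type u} (G : Digraph V) where
  /-- the nodes of the decomposition -/
  N : Type
  [fintype : Fintype N]
  /-- the underlying DAG -/
  T : Digraph N
  acyclic : ∀ i, ¬ Relation.TransGen T.Adj i i
  /-- the bags that partition the vertex set -/
  W : N → Set V
  /-- the guarding bags -/
  X : N → Set V
  nonempty : ∀ i, (W i).Nonempty
  partition : ∀ v, ∃! i, v ∈ W i
  guards : ∀ i, G.Guards (X i) (bagsFrom T W i)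
  /-- the children of every node have a suitable enumeration -/
  children : ∀ i, ∃ (s : ℕ) (j : Fin s → N), Function.Injective j ∧
    Set.range j = {t | T.Adj i t} ∧
    ∀ q, X (j q) ⊆ W i ∪ X i ∪ ⋃ p ∈ Set.Iio q, bagsFrom T W (j p)
  /-- the roots have a suitable enumeration -/
  roots : ∃ (s : ℕ) (r : Fin s → N), Function.Injective r ∧
    Set.range r = {t | ∀ i, ¬ T.Adj i t} ∧
    ∀ q, X (r q) ⊆ ⋃ p ∈ Set.Iio q, bagsFrom T W (r p)

/-- The maximum of `|W i ∪ X i|` over all nodes `i`. -/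
noncomputable def KellyDecomposition.width {V : Type u} {G : Digraph V}
    (D : KellyDecomposition G) : ℕ :=
  (@Finset.univ D.N D.fintype).sup fun i => (D.W i ∪ D.X i).ncard

/-- The minimum width of a Kelly-decomposition of the finite digraph `G`. -/
noncomputable def kellyWidth {V : Type u} (G : Digraph V) : ℕ :=
  sInf (Set.range (KellyDecomposition.width (G := G)))

/-- Every digraph on a nonempty set has a Kelly-decomposition with one node, and the null digraph
has one without nodes, so that `kellyWidth` is a minimum. -/
theorem nonempty_kellyDecomposition {V : Type u} (G : Digraph V) :
    Nonempty (KellyDecomposition G) := by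
  rcases isEmpty_or_nonempty V with hV | hV
  · exact ⟨{
      N := Empty
      T := ⟨fun _ _ => False⟩
      acyclic := fun i => i.elim
      W := fun i => i.elim
      X := fun i => i.elim
      nonempty := fun i => i.elim
      partition := fun v => (hV.false v).elim
      guards := fun i => i.elim
      children := fun i => i.elim
      roots := ⟨0, Fin.elim0, fun i => i.elim0, by ext x; exact x.elim, fun q => q.elim0⟩ }⟩
  · have hb : ∀ i : Unit, bagsFrom (⟨fun _ _ => False⟩ : Digraph Unit)
        (fun _ => (Set.univ : Set V)) i = Set.univ := by
      intro i
      refine Set.eq_univ_of_forall fun v => ?_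
      exact Set.mem_biUnion (x := i) Relation.ReflTransGen.refl (Set.mem_univ v)
    exact ⟨{
      N := Unit
      T := ⟨fun _ _ => False⟩
      acyclic := fun i h => by
        obtain ⟨_, _, h'⟩ := Relation.TransGen.tail'_iff.mp h
        exact h'
      W := fun _ => Set.univ
      X := fun _ => ∅
      nonempty := fun _ => Set.univ_nonempty
      partition := fun v => ⟨(), Set.mem_univ v, fun _ _ => rfl⟩
      guards := fun i => by
        rw [hb]
        exact ⟨disjoint_bot_right, fun _ _ _ _ => Or.inl (Set.mem_univ _)⟩
      children := fun i => ⟨0, Fin.elim0, fun i => i.elim0, by ext x; simp, fun q => q.elim0⟩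
      roots := ⟨1, fun _ => (), fun _ _ _ => Subsingleton.elim _ _, by ext x; simp,
        fun _ => Set.empty_subset _⟩ }⟩

/-! ### The three forbidden digraphs -/

/-- The complete digraph on three vertices. -/
def K3 : Digraph (Fin 3) where
  Adj x y := x ≠ y

/-- The bidirected path `0, 1, 2, 3` together with the edges `(0, 2)` and `(3, 1)`. -/
def N4 : Digraph (Fin 4) where
  Adj x y := (x.val + 1 = y.val ∨ y.val + 1 = x.val) ∨ (x = 0 ∧ y = 2) ∨ (x = 3 ∧ y = 1)

/-- The bidirected path `0, 1, 2, 3, 4` together with the edges `(0, 2)` and `(4, 2)`. -/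
def M5 : Digraph (Fin 5) where
  Adj x y := (x.val + 1 = y.val ∨ y.val + 1 = x.val) ∨ (x = 0 ∧ y = 2) ∨ (x = 4 ∧ y = 2)

end Digraph

namespace Digraph

/-! ### Generalities on directed minors -/

/-! The link between all the conditions is `LocallyNarrow`: for every nonempty vertex set `U` some
set `A` meets `U` in one vertex and has at most one exit. Partial 1-DAGs have this property by
induction on the construction, and digraphs of Kelly-width at most 2 have it by taking a lowest node
of the decomposition whose descendants' bags meet `U`. It passes to directed minors (the hard cases
are in-contraction and cycle contraction), and for `U = univ` it forces `A` to be a single vertex,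
hence of out-degree at most one. Every vertex of `K3`, `N4` and `M5` has out-degree at least two, so
none of them is a minor.

Conversely, `MinOutTwo.hasForbiddenMinor` shows that a nonempty finite digraph of minimum out-degree
two has a forbidden minor. A minor-minimal one has out-degree exactly two, and the failure of each
contraction to give a smaller example pins down the structure until one of the three digraphs
appears. Hence without forbidden minors some vertex has out-degree at most one. Eliminating it is
itself a minor operation, so this repeats until the digraph is empty. Reversing such an elimination
(`Eliminable`) builds both a 1-DAG containing `G` and a Kelly-decomposition of width at most 2. -/

theorem ReducesTo.trans {V W X : Type u} {G : Digraph V} {H : Digraph W} {K : Digraph X}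
    (h₁ : G.ReducesTo H) (h₂ : H.ReducesTo K) : G.ReducesTo K := by
  induction h₂ with
  | refl => exact h₁
  | deleteVertex _ v ih => exact ih.deleteVertex v
  | deleteEdge _ u v huv ih => exact ih.deleteEdge u v huv
  | contractCycle _ c hc ih => exact ih.contractCycle c hc
  | outContract _ u v huv ih => exact ih.outContract u v huv
  | inContract _ u v huv ih => exact ih.inContract u v huv

theorem IsDirectedMinor.of_reducesTo {U : Type*} {V W : Type u} {K : Digraph U} {G : Digraph V}
    {H : Digraph W} (h : G.ReducesTo H) (hK : K.IsDirectedMinor H) : K.IsDirectedMinor G := by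
  obtain ⟨X, L, hL, e⟩ := hK
  exact ⟨X, L, h.trans hL, e⟩

/-- A finite digraph reduces to each of its spanning subgraphs. -/
theorem reducesTo_of_adj_imp {V : Type u} [Finite V] {H : Digraph V} (G : Digraph V)
    (hle : ∀ x y, H.Adj x y → G.Adj x y) : G.ReducesTo H := by
  induction hn : {p : V × V | G.Adj p.1 p.2 ∧ ¬ H.Adj p.1 p.2}.ncard using Nat.strong_induction_on
    generalizing G with
  | _ n ih =>
    by_cases hex : ∃ x y, G.Adj x y ∧ ¬ H.Adj x y
    · obtain ⟨x, y, hG, hH⟩ := hex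
      refine ((ReducesTo.refl (G := G)).deleteEdge x y hG).trans
        (ih _ ?_ (G.deleteEdge x y) ?_ rfl)
      · rw [← hn]
        refine Set.ncard_lt_ncard ⟨fun p hp => ⟨hp.1.1, hp.2⟩, fun h => ?_⟩ (Set.toFinite _)
        exact (h (a := (x, y)) ⟨hG, hH⟩).1.2 ⟨rfl, rfl⟩
      · rintro a b hab
        refine ⟨hle a b hab, ?_⟩
        rintro ⟨rfl, rfl⟩
        exact hH hab
    · push Not at hex
      have : G = H := by
        ext x y
        exact ⟨hex x y, hle x y⟩
      rw [this]
      exact .refl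

/-- A digraph that embeds into a finite digraph is a directed minor of it. -/
theorem isDirectedMinor_of_embedding {U : Type*} {V : Type u} [Finite V] {H : Digraph U}
    (G : Digraph V) (f : U → V) (hf : Function.Injective f)
    (hadj : ∀ x y, H.Adj x y → G.Adj (f x) (f y)) : H.IsDirectedMinor G := by
  induction hn : Nat.card V using Nat.strong_induction_on generalizing V with
  | _ n ih =>
    by_cases hs : Function.Surjective f
    · let e := Equiv.ofBijective f ⟨hf, hs⟩
      refine ⟨V, ⟨fun x y => H.Adj (e.symm x) (e.symm y)⟩, reducesTo_of_adj_imp G ?_,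
        ⟨⟨e, by simp⟩⟩⟩
      intro x y hxy
      have := hadj _ _ hxy
      have he : ∀ x, f (e.symm x) = x := e.apply_symm_apply
      rwa [he, he] at this
    · obtain ⟨v, hv⟩ := not_forall.mp hs
      push Not at hv
      refine .of_reducesTo ((ReducesTo.refl (G := G)).deleteVertex v) (ih _ ?_
        (G.deleteVertex v) (fun x => ⟨f x, hv x⟩) (fun x y h => hf (congrArg Subtype.val h))
        (fun x y h => hadj x y h) rfl)
      rw [← hn]
      exact Finite.card_subtype_lt (x := v) (by simp)

/-- One of the three forbidden digraphs is a directed minor. -/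
def HasForbiddenMinor {V : Type u} (G : Digraph V) : Prop :=
  K3.IsDirectedMinor G ∨ N4.IsDirectedMinor G ∨ M5.IsDirectedMinor G

theorem HasForbiddenMinor.of_reducesTo {V W : Type u} {G : Digraph V} {H : Digraph W}
    (h : G.ReducesTo H) (hH : H.HasForbiddenMinor) : G.HasForbiddenMinor :=
  hH.imp (.of_reducesTo h) (Or.imp (.of_reducesTo h) (.of_reducesTo h))

/-! ### Digraphs of minimum out-degree two have a forbidden minor -/

/-- Every vertex has at least two out-neighbours other than itself. -/
def MinOutTwo {V : Type u} (G : Digraph V) : Prop :=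
  ∀ x, ∃ y z, x ≠ y ∧ x ≠ z ∧ y ≠ z ∧ G.Adj x y ∧ G.Adj x z

/-- The out-neighbours of `x` are exactly the two vertices `y ≠ z`. -/
def Out {V : Type u} (G : Digraph V) (x y z : V) : Prop :=
  y ≠ z ∧ ∀ t, G.Adj x t ↔ t = y ∨ t = z

section Out

variable {V : Type u} {G : Digraph V}

theorem Out.symm {x y z : V} (h : G.Out x y z) : G.Out x z y :=
  ⟨h.1.symm, fun t => (h.2 t).trans or_comm⟩

theorem Out.left {x y z : V} (h : G.Out x y z) : G.Adj x y := (h.2 y).2 (.inl rfl)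

theorem Out.right {x y z : V} (h : G.Out x y z) : G.Adj x z := (h.2 z).2 (.inr rfl)

theorem Out.eq_right {x y z w : V} (h : G.Out x y z) (h' : G.Out x y w) : z = w :=
  ((h'.2 z).1 h.right).resolve_left h.1.symm

end Out

/-- A loopless digraph of constant out-degree two that does not reduce to a smaller digraph of
minimum out-degree at least two. -/
structure IsMinimalOutTwo {V : Type u} (G : Digraph V) : Prop where
  ne : ∀ {x y}, G.Adj x y → x ≠ y
  out : ∀ x, ∃ y z, G.Out x y z
  minimal : ∀ {W : Type u} [Finite W] (H : Digraph W), G.ReducesTo H → Nonempty W →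
    Nat.card W < Nat.card V → ¬ H.MinOutTwo

/-! ### Structure of minimal digraphs of out-degree two -/

namespace IsMinimalOutTwo

variable {V : Type u} {G : Digraph V}

theorem exists_out_of_adj (hG : G.IsMinimalOutTwo) {u v : V} (h : G.Adj u v) :
    ∃ w, G.Out u v w := by
  obtain ⟨y, z, hyz⟩ := hG.out u
  rcases (hyz.2 v).1 h with rfl | rfl
  · exact ⟨z, hyz⟩
  · exact ⟨y, hyz.symm⟩

variable [Finite V]

/-- Out-contracting `(u, v)` replaces the out-neighbour `u` by `v`. A vertex loses out-degree only
if it already pointed to both, or if it is `v` itself and points to `u`. By minimality some vertex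
must lose. -/
theorem exists_out_pair (hG : G.IsMinimalOutTwo) {u v : V} (huv : G.Adj u v)
    (hvu : ¬ G.Adj v u) : ∃ x, G.Out x u v := by
  by_contra hno
  push Not at hno
  refine hG.minimal _ (ReducesTo.refl.outContract u v huv) ⟨⟨v, (hG.ne huv).symm⟩⟩
    (Finite.card_subtype_lt (x := u) (by simp)) ?_
  rintro ⟨x, hx⟩
  by_cases hxu : G.Adj x u
  · obtain ⟨z, hz⟩ := hG.exists_out_of_adj hxu
    have hxv : x ≠ v := by
      rintro rfl
      exact hvu hxu
    have hzv : v ≠ z := by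
      rintro rfl
      exact hno x hz
    exact ⟨⟨v, (hG.ne huv).symm⟩, ⟨z, hz.1.symm⟩, by simpa using hxv,
      by simpa using hG.ne hz.right, by simpa using hzv,
      ⟨by simpa using hxv, .inr ⟨rfl, hxu⟩⟩, ⟨by simpa using hG.ne hz.right, .inl hz.right⟩⟩
  · obtain ⟨y, z, h⟩ := hG.out x
    have hy : y ≠ u := by
      rintro rfl
      exact hxu h.left
    have hz : z ≠ u := by
      rintro rfl
      exact hxu h.right
    exact ⟨⟨y, hy⟩, ⟨z, hz⟩, by simpa using hG.ne h.left, by simpa using hG.ne h.right,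
      by simpa using h.1, ⟨by simpa using hG.ne h.left, .inl h.left⟩,
      ⟨by simpa using hG.ne h.right, .inl h.right⟩⟩

/-- Contract the two-cycle on `u, v`. The new vertex has out-neighbours `a` and `b`, and another
vertex loses out-degree only if it points to both `u` and `v`. -/
theorem eq_or_exists_out_pair (hG : G.IsMinimalOutTwo) {u v a b : V} (hu : G.Out u v a)
    (hv : G.Out v u b) : a = b ∨ ∃ x, G.Out x u v := by
  by_contra! hno
  obtain ⟨hab, hno⟩ := hno
  have huv := hG.ne hu.left
  have hmem : ∀ x, x ∈ Set.range ![u, v] ↔ x = u ∨ x = v := by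
    intro x
    simp [Matrix.range_cons, Matrix.range_empty, or_comm]
  -- Cycles have length `n + 2`, so `n := 0` is a two-cycle.
  have hcyc : G.IsDirectedCycle (n := 0) ![u, v] := by
    refine ⟨?_, ?_⟩
    · intro i j
      fin_cases i <;> fin_cases j <;> simp [huv, huv.symm]
    · intro i
      fin_cases i
      · exact hu.left
      · exact hv.left
  refine hG.minimal _ (ReducesTo.refl.contractCycle _ hcyc) ⟨none⟩ ?_ ?_
  · have h1 : Nat.card {x // x ∉ Set.range ![u, v]} + 2 = Nat.card V := by
      have := Set.ncard_add_ncard_compl (Set.range ![u, v])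
      rw [Set.ncard_congr' (Equiv.setCongr (t := {u, v}) (Set.ext hmem)),
        Set.ncard_pair huv] at this
      rw [← this, add_comm]
      rfl
    rw [Finite.card_option]
    omega
  · rintro (_ | ⟨x, hx⟩)
    · have ha : a ∉ Set.range ![u, v] := by
        rw [hmem]
        rintro (rfl | rfl)
        · exact hG.ne hu.right rfl
        · exact hu.1 rfl
      have hb : b ∉ Set.range ![u, v] := by
        rw [hmem]
        rintro (rfl | rfl)
        · exact hv.1 rfl
        · exact hG.ne hv.right rfl
      exact ⟨some ⟨a, ha⟩, some ⟨b, hb⟩, by simp, by simp, by simpa using hab,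
        ⟨u, ⟨0, rfl⟩, hu.right⟩, ⟨v, ⟨1, rfl⟩, hv.right⟩⟩
    · have key : ∀ c, c = u ∨ c = v → G.Adj x c → ∃ y z, (some ⟨x, hx⟩ : Option _) ≠ y ∧
          some ⟨x, hx⟩ ≠ z ∧ y ≠ z ∧ (G.contractSet (Set.range ![u, v])).Adj (some ⟨x, hx⟩) y ∧
            (G.contractSet (Set.range ![u, v])).Adj (some ⟨x, hx⟩) z := by
        intro c hc hxc
        obtain ⟨z, hz⟩ := hG.exists_out_of_adj hxc
        have hzC : z ∉ Set.range ![u, v] := by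
          rw [hmem]
          rintro (rfl | rfl) <;> rcases hc with rfl | rfl
          · exact hz.1 rfl
          · exact hno x hz.symm
          · exact hno x hz
          · exact hz.1 rfl
        exact ⟨none, some ⟨z, hzC⟩, by simp, by simpa using hG.ne hz.right, by simp,
          ⟨c, (hmem c).2 hc, hxc⟩, hz.right⟩
      by_cases hxu : G.Adj x u
      · exact key u (.inl rfl) hxu
      by_cases hxv : G.Adj x v
      · exact key v (.inr rfl) hxv
      obtain ⟨y, z, h⟩ := hG.out x
      have aux : ∀ y, G.Adj x y → y ∉ Set.range ![u, v] := by
        intro y hy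
        rw [hmem]
        rintro (rfl | rfl)
        · exact hxu hy
        · exact hxv hy
      exact ⟨some ⟨y, aux y h.left⟩, some ⟨z, aux z h.right⟩, by simpa using hG.ne h.left,
        by simpa using hG.ne h.right, by simpa using h.1, h.left, h.right⟩

/-- Out-contract `x` into `u` and then `u` into `v`: out-neighbours in `{u, x}` become `v`. If every
other vertex had an out-neighbour outside `{u, x, v}`, all out-degrees would stay at least two. -/
theorem exists_out_subset_triple (hG : G.IsMinimalOutTwo) {u x v : V} (hu : G.Out u x v)
    (hx : G.Out x u v) (hvu : ¬ G.Adj v u) (hvx : ¬ G.Adj v x) :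
    ∃ y, y ≠ u ∧ y ≠ x ∧ y ≠ v ∧ ∀ t, G.Adj y t → t = u ∨ t = x ∨ t = v := by
  by_contra! hno
  have hux := hG.ne hu.left
  have hxv := hG.ne hx.right
  have huv := hG.ne hu.right
  have hadj : (G.outContract x u).Adj ⟨u, hux⟩ ⟨v, hxv.symm⟩ :=
    ⟨by simpa using huv, .inl hu.right⟩
  refine hG.minimal _ ((ReducesTo.refl.outContract x u hx.left).outContract _ _ hadj)
    ⟨⟨⟨v, hxv.symm⟩, by simpa using huv.symm⟩⟩ ?_ ?_
  · exact (Finite.card_subtype_lt (x := ⟨u, hux⟩) (by simp)).trans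
      (Finite.card_subtype_lt (x := x) (by simp))
  rintro ⟨⟨y, hyx⟩, hyu⟩
  have hyu' : y ≠ u := by simpa using hyu
  have hkeep : ∀ t (h₁ : t ≠ x) (h₂ : t ≠ u), G.Adj y t →
      ((G.outContract x u).outContract ⟨u, hux⟩ ⟨v, hxv.symm⟩).Adj ⟨⟨y, hyx⟩, hyu⟩
        ⟨⟨t, h₁⟩, by simpa using h₂⟩ := by
    intro t h₁ h₂ h
    have := hG.ne h
    exact ⟨by simpa using this, .inl ⟨by simpa using this, .inl h⟩⟩
  have hnew : y ≠ v → G.Adj y u ∨ G.Adj y x →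
      ((G.outContract x u).outContract ⟨u, hux⟩ ⟨v, hxv.symm⟩).Adj ⟨⟨y, hyx⟩, hyu⟩
        ⟨⟨v, hxv.symm⟩, by simpa using huv.symm⟩ := by
    intro hyv h
    refine ⟨by simpa using hyv, .inr ⟨rfl, by simpa using hyu', ?_⟩⟩
    exact h.imp id fun h => ⟨rfl, h⟩
  by_cases hyout : G.Adj y u ∨ G.Adj y x
  · have hyv : y ≠ v := by
      rintro rfl
      exact hyout.elim hvu hvx
    obtain ⟨t, ht, htu, htx, htv⟩ := hno y hyu' hyx hyv
    exact ⟨_, _, by simpa using hyv, by simpa using hG.ne ht, by simpa using htv.symm,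
      hnew hyv hyout, hkeep t htx htu ht⟩
  · obtain ⟨s, t, h⟩ := hG.out y
    have aux : ∀ t, G.Adj y t → t ≠ u ∧ t ≠ x := by
      intro t ht
      exact ⟨fun e => hyout (.inl (e ▸ ht)), fun e => hyout (.inr (e ▸ ht))⟩
    exact ⟨_, _, by simpa using hG.ne h.left, by simpa using hG.ne h.right, by simpa using h.1,
      hkeep s (aux s h.left).2 (aux s h.left).1 h.left,
      hkeep t (aux t h.right).2 (aux t h.right).1 h.right⟩

/-- An edge without a reverse edge ends at the common out-neighbour of a two-cycle. -/
theorem exists_twoCycle (hG : G.IsMinimalOutTwo) {u v : V} (huv : G.Adj u v)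
    (hvu : ¬ G.Adj v u) : ∃ x, G.Out x u v ∧ G.Out u x v := by
  by_contra hno
  -- Without such a two-cycle, each in-neighbour `x` of `u` yields an in-neighbour `φ x` with
  -- out-set `{x, u}`. Out-sets make `φ` injective, hence surjective by finiteness. But some
  -- in-neighbour of `u` has out-set `{u, v}`, so its preimage is `v`, which is not an in-neighbour
  -- of `u`.
  have hnext : ∀ x : {x // G.Adj x u}, ∃ y : {x // G.Adj x u}, G.Out y x u := by
    rintro ⟨x, hxu⟩
    suffices ∃ y, G.Out y x u by
      obtain ⟨y, hy⟩ := this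
      exact ⟨⟨y, hy.right⟩, hy⟩
    by_cases hux : G.Adj u x
    · have hu : G.Out u x v := by
        obtain ⟨w, hw⟩ := hG.exists_out_of_adj hux
        rcases (hw.2 v).1 huv with rfl | rfl
        · exact absurd hxu hvu
        · exact hw
      obtain ⟨p, hp⟩ := hG.exists_out_of_adj hxu
      rcases hG.eq_or_exists_out_pair hp hu with rfl | h
      · exact absurd ⟨x, hp, hu⟩ hno
      · exact h
    · exact hG.exists_out_pair hxu hux
  choose φ hφ using hnext
  have hinj : Function.Injective φ := by
    intro x y hxy
    have hx := (hφ x).symm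
    rw [hxy] at hx
    exact Subtype.ext (hx.eq_right (hφ y).symm)
  obtain ⟨x, hx⟩ := hG.exists_out_pair huv hvu
  obtain ⟨y, hy⟩ := Finite.surjective_of_injective hinj ⟨x, hx.left⟩
  have := (hφ y).symm
  rw [hy] at this
  exact hvu (this.eq_right hx ▸ y.2)

/-- Otherwise `exists_out_subset_triple` gives a vertex `y`. An edge from `y` to `u` or `x` has no
reverse, and the two-cycle that `exists_twoCycle` attaches to it has no possible second vertex. So
`y` could point only to `v`. -/
theorem adj_of_twoCycle (hG : G.IsMinimalOutTwo) {u x v : V} (hvu : ¬ G.Adj v u)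
    (hx : G.Out x u v) (hu : G.Out u x v) : G.Adj v x := by
  by_contra hvx
  obtain ⟨y, hyu, hyx, hyv, hy⟩ := hG.exists_out_subset_triple hu hx hvu hvx
  have key : ∀ a b, G.Out a b v → G.Out b a v → ¬ G.Adj v a → y ≠ b →
      (∀ t, G.Adj y t → t = a ∨ t = b ∨ t = v) → ¬ G.Adj y a := by
    intro a b ha hb hva hyb hy hya
    have hay : ¬ G.Adj a y := by
      rw [ha.2]
      tauto
    obtain ⟨z, hz, hz'⟩ := hG.exists_twoCycle hya hay
    rcases hy z hz'.left with rfl | rfl | rfl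
    · exact hz'.1 rfl
    · rcases (hb.2 y).1 hz.left with rfl | rfl
      · exact hG.ne hya rfl
      · exact hyv rfl
    · exact hva hz.right
  have h₁ := key u x hu hx hvu hyx hy
  have h₂ := key x u hx hu hvx hyu fun t ht => by
    have := hy t ht
    tauto
  obtain ⟨s, t, h⟩ := hG.out y
  have aux : ∀ t, G.Adj y t → t = v := by
    intro t ht
    rcases hy t ht with rfl | rfl | rfl
    · exact absurd ht h₁
    · exact absurd ht h₂
    · rfl
  exact h.1 ((aux s h.left).trans (aux t h.right).symm)

/-- If all edges are bidirected, a two-cycle lies in a triangle. Otherwise an edge `u → v` without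
reverse generates the bidirected path `u, x, v, w` with `u → v`; applying `eq_or_exists_out_pair` to
the two-cycle `v, w` either gives `w → x`, hence `N4`, or a fifth vertex, hence `M5`. -/
theorem hasForbiddenMinor [Nonempty V] (hG : G.IsMinimalOutTwo) : G.HasForbiddenMinor := by
  by_cases hsym : ∀ u v, G.Adj u v → G.Adj v u
  · have triangle : ∀ x y z, G.Adj x y → G.Adj x z → G.Adj y z → K3.IsDirectedMinor G := by
      intro x y z hxy hxz hyz
      have hyx := hsym _ _ hxy
      have hzx := hsym _ _ hxz
      have hzy := hsym _ _ hyz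
      refine isDirectedMinor_of_embedding G ![x, y, z] ?_ ?_
      · have h₁ := hG.ne hxy
        have h₂ := hG.ne hxz
        have h₃ := hG.ne hyz
        intro i j
        fin_cases i <;> fin_cases j <;> simp [h₁, h₂, h₃, h₁.symm, h₂.symm, h₃.symm]
      · intro i j
        fin_cases i <;> fin_cases j <;> simp [K3, *]
    obtain ⟨u⟩ := ‹Nonempty V›
    obtain ⟨v, a, hu⟩ := hG.out u
    obtain ⟨b, hv⟩ := hG.exists_out_of_adj (hsym _ _ hu.left)
    left
    rcases hG.eq_or_exists_out_pair hu hv with rfl | ⟨y, hy⟩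
    · exact triangle u v a hu.left hu.right hv.right
    · exact triangle y u v hy.left hy.right hu.left
  · right
    push Not at hsym
    obtain ⟨u, v, huv, hvu⟩ := hsym
    obtain ⟨x, hx, hu⟩ := hG.exists_twoCycle huv hvu
    have hvx := hG.adj_of_twoCycle hvu hx hu
    obtain ⟨w, hv⟩ := hG.exists_out_of_adj hvx
    have hwu : w ≠ u := by
      rintro rfl
      exact hvu hv.right
    have hux := hG.ne hu.left
    have hxv := hG.ne hx.right
    have huv' := hG.ne huv
    have hvw := hG.ne hv.right
    have hxw := hv.1
    have hwv : G.Adj w v := by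
      by_contra hwv
      obtain ⟨z, hz, hz'⟩ := hG.exists_twoCycle hv.right hwv
      obtain rfl := hz'.symm.eq_right hv.symm
      exact hwu (hz.eq_right hx.symm)
    have := hu.left
    have := hx.left
    have := hx.right
    have := hv.right
    obtain ⟨t, hw⟩ := hG.exists_out_of_adj hwv
    rcases hG.eq_or_exists_out_pair hv.symm hw with rfl | ⟨y, hy⟩
    · left
      have := hw.right
      refine isDirectedMinor_of_embedding G ![u, x, v, w] ?_ ?_
      · intro i j
        fin_cases i <;> fin_cases j <;> simp [hux, hxv, huv', hvw, hxw, hwu, hux.symm, hxv.symm,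
          huv'.symm, hvw.symm, hxw.symm, hwu.symm]
      · intro i j
        fin_cases i <;> fin_cases j <;> simp [N4, *]
    · right
      have hyu : y ≠ u := by
        rintro rfl
        exact hxw (hu.symm.eq_right hy)
      have hyx : y ≠ x := by
        rintro rfl
        exact hwu (hy.eq_right hx.symm)
      have hyw := hG.ne hy.right
      have hyv := hG.ne hy.left
      have hvy : ¬ G.Adj v y := by
        rw [hv.2]
        tauto
      obtain ⟨z, hz, hz'⟩ := hG.exists_twoCycle hy.left hvy
      obtain rfl := hz'.symm.eq_right hy
      have := hy.left
      have := hy.right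
      have := hz.left
      refine isDirectedMinor_of_embedding G ![u, x, v, z, y] ?_ ?_
      · intro i j
        fin_cases i <;> fin_cases j <;> simp [hux, hxv, huv', hvw, hxw, hwu, hux.symm, hxv.symm,
          huv'.symm, hvw.symm, hxw.symm, hwu.symm, hyu, hyx, hyw, hyv, hyu.symm, hyx.symm,
          hyw.symm, hyv.symm]
      · intro i j
        fin_cases i <;> fin_cases j <;> simp [M5, *]

end IsMinimalOutTwo

theorem MinOutTwo.hasForbiddenMinor {V : Type u} [Finite V] [Nonempty V] {G : Digraph V}
    (hG : G.MinOutTwo) : G.HasForbiddenMinor := by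
  induction hn : Nat.card V using Nat.strong_induction_on generalizing V with
  | _ n ih =>
    choose f g hf hg hfg haf hag using hG
    by_contra hno
    have hred : G.ReducesTo ⟨fun x y => y = f x ∨ y = g x⟩ := by
      refine reducesTo_of_adj_imp G ?_
      rintro x y (rfl | rfl)
      · exact haf x
      · exact hag x
    have hmin : IsMinimalOutTwo (⟨fun x y => y = f x ∨ y = g x⟩ : Digraph V) := by
      refine ⟨?_, fun x => ⟨f x, g x, hfg x, fun t => Iff.rfl⟩, ?_⟩
      · rintro x y (rfl | rfl)
        · exact hf x
        · exact hg x
      · intro W _ H hH hW hcard hmin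
        exact hno (.of_reducesTo (hred.trans hH) (ih _ (hn ▸ hcard) hmin rfl))
    exact hno (.of_reducesTo hred hmin.hasForbiddenMinor)


/-! ### A property that is inherited by directed minors -/

/-- Every edge that leaves `A` has the head `z`. -/
def ExitsAt {V : Type u} (G : Digraph V) (A : Set V) (z : V) : Prop :=
  ∀ a ∈ A, ∀ y, G.Adj a y → y ∈ A ∨ y = z

/-- Every nonempty vertex set `U` meets, in exactly one vertex, a set with at most one exit. -/
def LocallyNarrow {V : Type u} (G : Digraph V) : Prop :=
  ∀ U : Set V, U.Nonempty →
    ∃ A z u, u ∈ A ∧ u ∈ U ∧ (∀ t ∈ A, t ∈ U → t = u) ∧ G.ExitsAt A z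

namespace LocallyNarrow

theorem of_embedding {V W : Type u} {G : Digraph V} {H : Digraph W} (hH : H.LocallyNarrow)
    (f : V → W) (hf : Function.Injective f) (hadj : ∀ x y, G.Adj x y → H.Adj (f x) (f y)) :
    G.LocallyNarrow := by
  intro U hU
  obtain ⟨A, z, _, huA, ⟨u, huU, rfl⟩, huniq, hA⟩ := hH (f '' U) (hU.image f)
  have huniq' : ∀ t ∈ f ⁻¹' A, t ∈ U → t = u :=
    fun t ht htU => hf (huniq _ ht ⟨t, htU, rfl⟩)
  by_cases hz : ∃ z', f z' = z
  · obtain ⟨z', rfl⟩ := hz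
    exact ⟨f ⁻¹' A, z', u, huA, huU, huniq', fun a ha y hay =>
      (hA _ ha _ (hadj _ _ hay)).imp id fun h => hf h⟩
  -- The exit of `A` is not in the image, so the preimage has no exit at all and `u` is a dummy.
  · exact ⟨f ⁻¹' A, u, u, huA, huU, huniq', fun a ha y hay =>
      .inl ((hA _ ha _ (hadj _ _ hay)).resolve_right fun h => hz ⟨y, h⟩)⟩

variable {V : Type u} {G : Digraph V}

/-- Restrict `A` to the remaining vertices. If the exit was `u`, it becomes `v`; otherwise an edge
from `A` to `u` means `u ∈ A`, so the redirected head `v` is in `A` or is the exit. -/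
theorem outContract (hG : G.LocallyNarrow) {u v : V} (huv : G.Adj u v) :
    (G.outContract u v).LocallyNarrow := by
  intro U hU
  obtain ⟨A, z, _, htA, ⟨t, htU, rfl⟩, huniq, hA⟩ := hG (Subtype.val '' U) (hU.image _)
  have huniq' : ∀ s ∈ Subtype.val ⁻¹' A, s ∈ U → s = t :=
    fun s hs hsU => Subtype.ext (huniq _ hs ⟨s, hsU, rfl⟩)
  have hv : u ∈ A → v ∈ A ∨ v = z := fun hu => hA u hu v huv
  by_cases hz : z = u
  · subst hz
    by_cases hvz : v = z
    · refine ⟨Subtype.val ⁻¹' A, t, t, htA, htU, huniq', ?_⟩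
      rintro ⟨a, ha⟩ haA ⟨y, hy⟩ ⟨-, h | ⟨h, -⟩⟩
      · exact .inl ((hA a haA y h).resolve_right hy)
      · exact absurd (h.trans hvz) hy
    · refine ⟨Subtype.val ⁻¹' A, ⟨v, hvz⟩, t, htA, htU, huniq', ?_⟩
      rintro ⟨a, ha⟩ haA ⟨y, hy⟩ ⟨-, h | ⟨rfl, -⟩⟩
      · exact .inl ((hA a haA y h).resolve_right hy)
      · exact .inr rfl
  · refine ⟨Subtype.val ⁻¹' A, ⟨z, hz⟩, t, htA, htU, huniq', ?_⟩
    rintro ⟨a, ha⟩ haA ⟨y, hy⟩ ⟨-, h | ⟨rfl, h⟩⟩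
    · exact (hA a haA y h).imp id Subtype.ext
    · exact (hv ((hA a haA u h).resolve_right (Ne.symm hz))).imp id Subtype.ext

theorem inContract (hG : G.LocallyNarrow) {u v : V} (huv : G.Adj u v) :
    (G.inContract u v).LocallyNarrow := by
  intro U hU
  have build : ∀ (A : Set V) (z : V) (t : {x // x ≠ v}), t.1 ∈ A → t ∈ U →
      (∀ s ∈ A, s ∈ Subtype.val '' U → s = t) →
      (∀ a ∈ A, a ≠ v → ∀ y, y ≠ v → G.Adj a y → y ∈ A ∨ y = z) →
      (u ∈ A → ∀ y, y ≠ v → G.Adj v y → y ∈ A ∨ y = z) →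
      ∃ A z t, t ∈ A ∧ t ∈ U ∧ (∀ s ∈ A, s ∈ U → s = t) ∧ (G.inContract u v).ExitsAt A z := by
    intro A z t htA htU huniq h₁ h₂
    have hexit : ∀ a y : {x // x ≠ v}, a.1 ∈ A → (G.inContract u v).Adj a y →
        y.1 ∈ A ∨ y.1 = z := by
      rintro ⟨a, ha⟩ ⟨y, hy⟩ haA ⟨-, h | ⟨rfl, h⟩⟩
      · exact h₁ a haA ha y hy h
      · exact h₂ haA y hy h
    have huniq' : ∀ s ∈ Subtype.val ⁻¹' A, s ∈ U → s = t :=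
      fun s hs hsU => Subtype.ext (huniq _ hs ⟨s, hsU, rfl⟩)
    by_cases hz : z = v
    · refine ⟨Subtype.val ⁻¹' A, t, t, htA, htU, huniq', fun a ha y hay => ?_⟩
      exact .inl ((hexit a y ha hay).resolve_right fun h => y.2 (h.trans hz))
    · exact ⟨Subtype.val ⁻¹' A, ⟨z, hz⟩, t, htA, htU, huniq', fun a ha y hay =>
        (hexit a y ha hay).imp id Subtype.ext⟩
  -- If `u ∈ A` and `v ∉ A`, then `v` is the only exit of `A`. Once `v` is gone, `A` without `u` can
  -- only exit at `u`, whatever out-neighbours `u` inherits.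
  have shrink : ∀ (A : Set V) (z : V) (t : {x // x ≠ v}), t.1 ∈ A → t ∈ U → t.1 ≠ u →
      (∀ s ∈ A, s ≠ u → s ∈ Subtype.val '' U → s = t) → G.ExitsAt A z → u ∈ A → v ∉ A →
      ∃ A z t, t ∈ A ∧ t ∈ U ∧ (∀ s ∈ A, s ∈ U → s = t) ∧ (G.inContract u v).ExitsAt A z := by
    intro A z t htA htU htu huniq hA huA hvA
    obtain rfl : v = z := (hA u huA v huv).resolve_left hvA
    refine build (A \ {u}) u t ⟨htA, htu⟩ htU (fun s hs => huniq s hs.1 hs.2) ?_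
      fun h => absurd rfl h.2
    intro a ha _ y hy hay
    by_cases hyu : y = u
    · exact .inr hyu
    · exact .inl ⟨(hA a ha.1 y hay).resolve_right hy, hyu⟩
  obtain ⟨A, z, _, htA, ⟨t, htU, rfl⟩, huniq, hA⟩ := hG (Subtype.val '' U) (hU.image _)
  by_cases huvA : u ∈ A → v ∈ A
  · exact build A z t htA htU huniq (fun a ha _ y _ => hA a ha y)
      fun hu y _ => hA v (huvA hu) y
  push Not at huvA
  obtain ⟨huA, hvA⟩ := huvA
  by_cases htu : t.1 = u
  swap
  · exact shrink A z t htA htU htu (fun s hs _ => huniq s hs) hA huA hvA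
  obtain rfl : v = z := (hA u huA v huv).resolve_left hvA
  -- Here `u` is the vertex of `A` in `U`, so it cannot be dropped. Trading `u` for `v` in `U` gives
  -- a second set `B`. If `B` contains `v`, it absorbs the only exit of `A`, and `A ∪ B` works;
  -- otherwise `B` works by itself, after `shrink` if `u ∈ B`.
  obtain ⟨B, w, s, hsB, hsU, huniq', hB⟩ :=
    hG (insert v (Subtype.val '' U \ {u})) ⟨v, .inl rfl⟩
  by_cases hsv : s = v
  · subst hsv
    refine build (A ∪ B) w t (.inl htA) htU ?_ ?_ fun _ y _ h => (hB s hsB y h).imp .inr id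
    · rintro r (hr | hr) hrU
      · exact huniq r hr hrU
      · by_cases hru : r = u
        · rw [hru, htu]
        · obtain ⟨r', hr', rfl⟩ := hrU
          exact absurd (huniq' _ hr (.inr ⟨⟨r', hr', rfl⟩, hru⟩)) r'.2
    · rintro a (ha | ha) _ y hy hay
      · exact .inl (.inl ((hA a ha y hay).resolve_right hy))
      · exact (hB a ha y hay).imp .inr id
  · obtain ⟨⟨s, hs, rfl⟩, hsu⟩ := hsU.resolve_left hsv
    have hvB : v ∉ B := fun h => hsv (huniq' v h (.inl rfl)).symm
    have huniq'' : ∀ r ∈ B, r ≠ u → r ∈ Subtype.val '' U → r = s :=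
      fun r hr hru hrU => huniq' r hr (.inr ⟨hrU, hru⟩)
    by_cases huB : u ∈ B
    · exact shrink B w s hsB hs hsu huniq'' hB huB hvB
    · exact build B w s hsB hs (fun r hr => huniq'' r hr fun h => huB (h ▸ hr))
        (fun a ha _ y _ => hB a ha y) fun h => absurd h huB

theorem contractSet (hG : G.LocallyNarrow) {C : Set V} (hne : C.Nonempty)
    (hC : ∀ A : Set V, (∃ c ∈ C, c ∈ A) → ¬ C ⊆ A → ∃ c ∈ C, c ∈ A ∧ ∃ d ∈ C, d ∉ A ∧ G.Adj c d) :
    (G.contractSet C).LocallyNarrow := by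
  intro U hU
  obtain ⟨c₀, hc₀⟩ := hne
  let S : Set V := {x | ∃ h : x ∉ C, some ⟨x, h⟩ ∈ U}
  have hSC : ∀ x ∈ S, x ∉ C := fun x hx => hx.1
  have hproj : ∀ z : V, ∃ z' : Option {x // x ∉ C}, (z ∈ C → z' = none) ∧
      ∀ h : z ∉ C, z' = some ⟨z, h⟩ := by
    intro z
    by_cases hz : z ∈ C
    · exact ⟨none, fun _ => rfl, fun h => absurd hz h⟩
    · exact ⟨some ⟨z, hz⟩, fun h => absurd h hz, fun _ => rfl⟩
  -- For `C ⊄ A` the set `A \ C` is used. If an edge from `A` enters `C`, then `z ∈ C`: it enters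
  -- either at `z` or in `A ∩ C`, from which an edge inside `C` leaves `A`. So the new exit is the
  -- image of `z`.
  have outside : ∀ (A : Set V) (z t : V), G.ExitsAt A z → t ∈ A → t ∈ S →
      (∀ s ∈ A, s ∈ S → s = t) → ¬ C ⊆ A →
      ∃ A z t, t ∈ A ∧ t ∈ U ∧ (∀ s ∈ A, s ∈ U → s = t) ∧ (G.contractSet C).ExitsAt A z := by
    rintro A z t hA htA ⟨htC, htU⟩ huniq hCA
    obtain ⟨z', hz', hz''⟩ := hproj z
    have hzC : ∀ a ∈ A, ∀ c ∈ C, G.Adj a c → z ∈ C := by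
      intro a ha c hc hac
      rcases hA a ha c hac with h | rfl
      · obtain ⟨c, hc, hcA, d, hd, hdA, hcd⟩ := hC A ⟨c, hc, h⟩ hCA
        exact (hA c hcA d hcd).resolve_left hdA ▸ hd
      · exact hc
    refine ⟨{x | ∃ y, x = some y ∧ y.1 ∈ A}, z', some ⟨t, htC⟩, ⟨_, rfl, htA⟩, htU, ?_, ?_⟩
    · rintro _ ⟨⟨s, hs⟩, rfl, hsA⟩ hsU
      simpa using huniq s hsA ⟨hs, hsU⟩
    · rintro _ ⟨⟨a, haC⟩, rfl, haA⟩ (_ | ⟨y, hy⟩) hay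
      · obtain ⟨c, hc, hac⟩ := hay
        exact .inr (hz' (hzC a haA c hc hac)).symm
      · rcases hA a haA y hay with h | rfl
        · exact .inl ⟨_, rfl, h⟩
        · exact .inr (hz'' hy).symm
  have inside : ∀ (A : Set V) (z : V) (t : Option {x // x ∉ C}), G.ExitsAt A z → C ⊆ A → t ∈ U →
      (∀ y, t = some y → y.1 ∈ A) → (∀ s ∈ U, (∀ y, s = some y → y.1 ∈ A) → s = t) →
      ∃ A z t, t ∈ A ∧ t ∈ U ∧ (∀ s ∈ A, s ∈ U → s = t) ∧ (G.contractSet C).ExitsAt A z := by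
    intro A z t hA hCA htU htA huniq
    obtain ⟨z', hz', hz''⟩ := hproj z
    refine ⟨{x | ∀ y, x = some y → y.1 ∈ A}, z', t, htA, htU, fun s hs hsU => huniq s hsU hs, ?_⟩
    have key : ∀ a ∈ A, ∀ y : {x // x ∉ C}, G.Adj a y →
        some y ∈ {x : Option {x // x ∉ C} | ∀ y, x = some y → y.1 ∈ A} ∨ some y = z' := by
      rintro a ha ⟨y, hy⟩ hay
      rcases hA a ha y hay with h | rfl
      · left
        rintro _ ⟨⟩
        exact h
      · exact .inr (hz'' hy).symm
    rintro (_ | ⟨a, ha⟩) haA (_ | y) hay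
    · exact hay.elim
    · obtain ⟨c, hc, hcy⟩ := hay
      exact key c (hCA hc) y hcy
    · exact .inl (by rintro _ ⟨⟩)
    · exact key a (haA _ rfl) y hay
  by_cases hnone : none ∈ U
  · by_contra hno
    -- If no suitable set arises directly, each `c ∈ C` has a set containing it, avoiding `S`, with
    -- exit in `C`. The union of these sets contains `C`, so it has no exit, and `c₀` serves as a
    -- dummy.
    have hall : ∀ c : C, ∃ A z, c.1 ∈ A ∧ z ∈ C ∧ G.ExitsAt A z ∧ ∀ s ∈ S, s ∉ A := by
      rintro ⟨c, hc⟩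
      obtain ⟨A, z, t, htA, htU, huniq, hA⟩ := hG (insert c S) ⟨c, .inl rfl⟩
      by_cases htc : t = c
      · subst htc
        have hS : ∀ s ∈ S, s ∉ A := fun s hs hsA => hSC s hs (huniq s hsA (.inr hs) ▸ hc)
        by_cases hCA : C ⊆ A
        · refine absurd (inside A z none hA hCA hnone (by rintro _ ⟨⟩) ?_) hno
          rintro (_ | ⟨s, hs⟩) hsU hsA
          · rfl
          · exact absurd (hsA _ rfl) (hS s ⟨hs, hsU⟩)
        · obtain ⟨c, hc, hcA, d, hd, hdA, hcd⟩ := hC A ⟨t, hc, htA⟩ hCA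
          exact ⟨A, z, htA, (hA c hcA d hcd).resolve_left hdA ▸ hd, hA, hS⟩
      · refine absurd (outside A z t hA htA (htU.resolve_left htc)
          (fun s hs hsS => huniq s hs (.inr hsS)) fun h => ?_) hno
        exact htc (huniq c (h hc) (.inl rfl)).symm
    choose A z hmem hz hA hS using hall
    refine hno (inside (⋃ c, A c) c₀ none ?_ (fun c hc => Set.mem_iUnion.2 ⟨⟨c, hc⟩, hmem _⟩)
      hnone (by rintro _ ⟨⟩) ?_)
    · intro a ha y hay
      obtain ⟨c, hac⟩ := Set.mem_iUnion.1 ha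
      rcases hA c a hac y hay with h | h
      · exact .inl (Set.mem_iUnion.2 ⟨c, h⟩)
      · exact .inl (Set.mem_iUnion.2 ⟨⟨y, h ▸ hz c⟩, hmem _⟩)
    · rintro (_ | ⟨s, hs⟩) hsU hsA
      · rfl
      · obtain ⟨c, hsc⟩ := Set.mem_iUnion.1 (hsA _ rfl)
        exact absurd hsc (hS c s ⟨hs, hsU⟩)
  · have hSne : S.Nonempty := by
      obtain ⟨_ | ⟨x, hx⟩, hxU⟩ := hU
      · exact absurd hxU hnone
      · exact ⟨x, hx, hxU⟩
    obtain ⟨A, z, t, htA, htS, huniq, hA⟩ := hG S hSne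
    by_cases hCA : C ⊆ A
    · obtain ⟨htC, htU⟩ := htS
      refine inside A z (some ⟨t, htC⟩) hA hCA htU (by rintro _ ⟨⟩; exact htA) ?_
      rintro (_ | ⟨s, hs⟩) hsU hsA
      · exact absurd hsU hnone
      · simpa using huniq s (hsA _ rfl) ⟨hs, hsU⟩
    · exact outside A z t hA htA htS huniq hCA

theorem contractCycle (hG : G.LocallyNarrow) {n : ℕ} {c : Fin (n + 2) → V}
    (hc : G.IsDirectedCycle c) : (G.contractSet (Set.range c)).LocallyNarrow := by
  refine hG.contractSet (Set.range_nonempty c) ?_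
  rintro A ⟨_, ⟨i, rfl⟩, hi⟩ hCA
  by_contra! hno
  -- If no cycle edge leaves `A`, membership propagates around the whole cycle.
  have hstep : ∀ k, c (i + k) ∈ A := by
    intro k
    induction k using Fin.induction with
    | zero => simpa using hi
    | succ k ih =>
      by_contra h
      refine hno _ ⟨_, rfl⟩ ih _ ⟨_, rfl⟩ h ?_
      rw [← Fin.coeSucc_eq_succ, ← add_assoc]
      exact hc.2 _
  apply hCA
  rintro _ ⟨j, rfl⟩
  have := hstep (j - i)
  rwa [add_sub_cancel] at this

theorem of_reducesTo {W : Type u} {H : Digraph W} (hG : G.LocallyNarrow) (h : G.ReducesTo H) :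
    H.LocallyNarrow := by
  induction h with
  | refl => exact hG
  | deleteVertex _ v ih => exact ih.of_embedding _ Subtype.val_injective fun _ _ h => h
  | deleteEdge _ u v _ ih => exact ih.of_embedding id Function.injective_id fun _ _ h => h.1
  | contractCycle _ c hc ih => exact ih.contractCycle hc
  | outContract _ u v huv ih => exact ih.outContract huv
  | inContract _ u v huv ih => exact ih.inContract huv

theorem exists_out_unique [Nonempty V] (hG : G.LocallyNarrow) :
    ∃ u z, ∀ y, G.Adj u y → y = u ∨ y = z := by
  obtain ⟨A, z, u, huA, -, huniq, hA⟩ := hG Set.univ Set.univ_nonempty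
  exact ⟨u, z, fun y hy => (hA u huA y hy).imp (fun h => huniq y h trivial) id⟩

theorem not_isDirectedMinor (hG : G.LocallyNarrow) {U : Type*} [Nonempty U] {H : Digraph U}
    (hH : ∀ u z, ∃ y, H.Adj u y ∧ y ≠ u ∧ y ≠ z) : ¬ H.IsDirectedMinor G := by
  rintro ⟨W, G', hred, ⟨e⟩⟩
  have : Nonempty W := ‹Nonempty U›.map e
  obtain ⟨u, z, h⟩ := (hG.of_reducesTo hred).exists_out_unique
  obtain ⟨y, hy, hyu, hyz⟩ := hH (e.symm u) (e.symm z)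
  have h' : G'.Adj u (e y) := by
    rw [← e.map_rel_iff, e.apply_symm_apply] at hy
    exact hy
  rcases h _ h' with rfl | rfl
  · exact hyu (e.symm_apply_apply y).symm
  · exact hyz (e.symm_apply_apply y).symm

theorem not_hasForbiddenMinor (hG : G.LocallyNarrow) : ¬ G.HasForbiddenMinor := by
  rintro (h | h | h) <;> refine hG.not_isDirectedMinor ?_ h
  · unfold K3
    decide
  · unfold N4
    decide
  · unfold M5
    decide

end LocallyNarrow

/-! ### Partial 1-DAGs and digraphs of Kelly-width at most two are locally narrow -/

theorem IsKDAG.finite {k : ℕ} {V : Type u} {G : Digraph V} (h : IsKDAG k G) : Finite V := by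
  induction h with
  | complete G hfin _ _ => exact hfin
  | extend G v _ _ _ _ ih =>
    have : Finite ({v}ᶜ : Set _) := ih
    exact Set.finite_univ_iff.1 ((Set.finite_singleton v).union (Set.toFinite {v}ᶜ) |>.subset
      fun x _ => by simp)

/-- If the new vertex `v` is in `U`, take `{v}`. Otherwise take the set `A` of `G - v`, adding `v`
if this creates no further exit. If it does, `v` has an out-neighbour `w` outside `A` and different
from `z`; an edge from `A` to `v` would force one to `w`, so `v` is not an exit of `A`. -/
theorem IsKDAG.locallyNarrow {V : Type u} {G : Digraph V} (h : IsKDAG 1 G) :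
    G.LocallyNarrow := by
  have hfin := h.finite
  generalize hk : 1 = k at h
  induction h with
  | complete G _ hcard _ =>
    subst hk
    have := (Nat.card_eq_one_iff_unique.1 hcard).1
    rintro U ⟨u, hu⟩
    exact ⟨Set.univ, u, u, trivial, hu, fun t _ _ => Subsingleton.elim _ _,
      fun _ _ _ _ => .inl trivial⟩
  | extend G v hH _ hout hin ih =>
    subst hk
    have hsub : ∀ w w', G.Adj v w → G.Adj v w' → w = w' :=
      fun w w' hw hw' => Set.ncard_le_one (Set.toFinite _) |>.1 hout w hw w' hw'
    intro U hU
    by_cases hv : v ∈ U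
    · have hz : ∃ z, ∀ w, G.Adj v w → w = z := by
        by_cases hw : ∃ w, G.Adj v w
        · obtain ⟨w, hw⟩ := hw
          exact ⟨w, fun w' hw' => hsub _ _ hw' hw⟩
        · exact ⟨v, fun w hw' => absurd ⟨w, hw'⟩ hw⟩
      obtain ⟨z, hz⟩ := hz
      refine ⟨{v}, z, v, rfl, hv, fun t ht _ => ht, ?_⟩
      rintro _ rfl y hy
      exact .inr (hz y hy)
    · have hne : (Subtype.val ⁻¹' U : Set {x // x ≠ v}).Nonempty := by
        obtain ⟨u, hu⟩ := hU
        exact ⟨⟨u, fun h => hv (h ▸ hu)⟩, hu⟩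
      obtain ⟨A, z, t, htA, htU, huniq, hA⟩ := ih inferInstance _ hne
      have hedge : ∀ a ∈ A, ∀ y (hy : y ≠ v), G.Adj a y → y ∈ Subtype.val '' A ∨ y = z := by
        intro a ha y hy hay
        exact (hA a ha ⟨y, hy⟩ hay).imp (fun h => ⟨_, h, rfl⟩) (congrArg Subtype.val)
      by_cases hvA : ∀ w, G.Adj v w → w ∈ Subtype.val '' A ∨ w = z
      · refine ⟨insert v (Subtype.val '' A), z, t, .inr ⟨t, htA, rfl⟩, htU, ?_, ?_⟩
        · rintro s (rfl | ⟨s, hs, rfl⟩) hsU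
          · exact absurd hsU hv
          · rw [huniq s hs hsU]
        · rintro _ (rfl | ⟨a, ha, rfl⟩) y hay
          · exact (hvA y hay).imp .inr id
          · by_cases hy : y = v
            · exact .inl (.inl hy)
            · exact (hedge a ha y hy hay).imp .inr id
      · push Not at hvA
        obtain ⟨w, hvw, hwA, hwz⟩ := hvA
        refine ⟨Subtype.val '' A, z, t, ⟨t, htA, rfl⟩, htU, ?_, ?_⟩
        · rintro _ ⟨s, hs, rfl⟩ hsU
          rw [huniq s hs hsU]
        · rintro _ ⟨a, ha, rfl⟩ y hay
          by_cases hy : y = v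
          · subst hy
            have hwa : w ≠ a := fun h => hwA ⟨a, ha, h.symm⟩
            have haw := (hin a a.2).1 hay w hvw hwa
            have hwy : w ≠ y := by
              rintro rfl
              contradiction
            exact absurd (hedge a ha w hwy haw) (by tauto)
          · exact hedge a ha y hy hay

theorem IsPartialKDAG.locallyNarrow {V : Type u} {G : Digraph V} (h : G.IsPartialKDAG 1) :
    G.LocallyNarrow := by
  obtain ⟨W, H, hH, f, hf, hadj⟩ := h
  exact hH.locallyNarrow.of_embedding f hf hadj

theorem KellyDecomposition.locallyNarrow {V : Type u} [Finite V] {G : Digraph V}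
    (D : KellyDecomposition G) (hD : D.width ≤ 2) : G.LocallyNarrow := by
  intro U hU
  let _ := D.fintype
  let r : D.N → D.N → Prop := fun i j => Relation.TransGen D.T.Adj j i
  have : IsTrans D.N r := ⟨fun _ _ _ h₁ h₂ => h₂.trans h₁⟩
  have : Std.Irrefl r := ⟨D.acyclic⟩
  -- A lowest node whose downward union of bags meets `U`: there `U` is met only within `W i`. As `W
  -- i ∪ X i` has at most two elements, either `W i` consists of two vertices of `U` and `X i` is
  -- empty, so that one of them can be removed and made the exit, or `X i` has at most one element
  -- and is the exit.
  obtain ⟨i, ⟨u, huU, hui⟩, hmin⟩ := (Finite.wellFounded_of_trans_of_irrefl r).has_min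
    {i | ∃ u ∈ U, u ∈ bagsFrom D.T D.W i} (by
      obtain ⟨u, hu⟩ := hU
      obtain ⟨i, hi, -⟩ := D.partition u
      exact ⟨i, u, hu, Set.mem_biUnion (x := i) Relation.ReflTransGen.refl hi⟩)
  have hbag : ∀ x ∈ U, x ∈ bagsFrom D.T D.W i → x ∈ D.W i := by
    intro x hxU hx
    obtain ⟨j, hij, hxj⟩ := Set.mem_iUnion₂.1 hx
    rcases (Relation.reflTransGen_iff_eq_or_transGen.1 hij) with rfl | h
    · exact hxj
    · exact absurd h (hmin j ⟨x, hxU, Set.mem_biUnion (x := j) Relation.ReflTransGen.refl hxj⟩)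
  have hWsub : D.W i ⊆ bagsFrom D.T D.W i :=
    fun x hx => Set.mem_biUnion (x := i) Relation.ReflTransGen.refl hx
  obtain ⟨hdisj, hguard⟩ := D.guards i
  have hcard : (D.W i ∪ D.X i).ncard ≤ 2 :=
    (Finset.le_sup (f := fun i => (D.W i ∪ D.X i).ncard) (Finset.mem_univ i)).trans hD
  have hthree : ∀ a b c, a ∈ D.W i ∪ D.X i → b ∈ D.W i ∪ D.X i → c ∈ D.W i ∪ D.X i →
      a ≠ b → a ≠ c → b = c := by
    intro a b c ha hb hc hab hac
    by_contra hbc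
    have := Set.ncard_le_ncard (s := {a, b, c}) (t := D.W i ∪ D.X i)
      (by rintro x (rfl | rfl | rfl) <;> assumption) (Set.toFinite _)
    rw [Set.ncard_eq_three.2 ⟨a, b, c, hab, hac, hbc, rfl⟩] at this
    omega
  have huW := hbag u huU hui
  have hX : ∀ x ∈ D.X i, ∀ y ∈ D.W i, y ≠ x := by
    rintro x hx y hy rfl
    exact hdisj.le_bot ⟨hWsub hy, hx⟩
  by_cases htwo : ∃ u' ∈ U, u' ∈ D.W i ∧ u ≠ u'
  · obtain ⟨u', hu'U, hu'W, hne⟩ := htwo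
    refine ⟨bagsFrom D.T D.W i \ {u'}, u', u, ⟨hui, hne⟩, huU, ?_, ?_⟩
    · rintro t ⟨ht, htu'⟩ htU
      by_contra htu
      exact htu' (hthree u t u' (.inl huW) (.inl (hbag t htU ht)) (.inl hu'W) (Ne.symm htu) hne)
    · rintro a ⟨ha, -⟩ y hay
      by_cases hy : y = u'
      · exact .inr hy
      · refine .inl ⟨(hguard a y hay ha).resolve_right fun hyX => ?_, hy⟩
        exact hy (hthree u y u' (.inl huW) (.inr hyX) (.inl hu'W) (hX y hyX u huW) hne)
  · push Not at htwo
    have hz : ∃ z, ∀ x ∈ D.X i, x = z := by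
      by_cases hx : ∃ x, x ∈ D.X i
      · obtain ⟨z, hz⟩ := hx
        exact ⟨z, fun x hx => hthree u x z (.inl huW) (.inr hx) (.inr hz) (hX x hx u huW)
          (hX z hz u huW)⟩
      · exact ⟨u, fun x hx' => absurd ⟨x, hx'⟩ hx⟩
    obtain ⟨z, hz⟩ := hz
    exact ⟨bagsFrom D.T D.W i, z, u, hui, huU, fun t ht htU => (htwo t htU (hbag t htU ht)).symm,
      fun a ha y hay => (hguard a y hay ha).imp id (hz y)⟩


/-! ### Elimination of vertices of out-degree at most one -/

/-- Delete `v` and join each of its in-neighbours to each of its out-neighbours. -/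
def eliminate {V : Type u} (G : Digraph V) (v : V) : Digraph {x : V // x ≠ v} where
  Adj x y := x ≠ y ∧ (G.Adj x y ∨ (G.Adj x v ∧ G.Adj v y))

/-- The vertices can be eliminated one by one, each having out-degree at most one when its turn
comes. -/
inductive Eliminable : {V : Type u} → Digraph V → Prop
  | empty {V : Type u} [IsEmpty V] (G : Digraph V) : Eliminable G
  | step {V : Type u} (G : Digraph V) (v : V) (hG : G.Loopless)
      (hout : ∀ w w', G.Adj v w → G.Adj v w' → w = w') (h : Eliminable (G.eliminate v)) :
      Eliminable G

/-- With one out-neighbour elimination is an out-contraction; with none it is a vertex deletion. -/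
theorem reducesTo_eliminate {V : Type u} {G : Digraph V} (hG : G.Loopless) {v : V}
    (hout : ∀ w w', G.Adj v w → G.Adj v w' → w = w') : G.ReducesTo (G.eliminate v) := by
  have hne : ∀ {x y}, G.Adj x y → x ≠ y := by
    rintro x _ h rfl
    exact hG x h
  by_cases hw : ∃ w, G.Adj v w
  · obtain ⟨w, hw⟩ := hw
    have : G.eliminate v = G.outContract v w := by
      ext x y
      refine and_congr_right fun _ => or_congr_right ?_
      rw [and_comm]
      refine and_congr_left fun _ => ⟨fun h => hout _ _ h hw, ?_⟩
      rintro rfl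
      exact hw
    rw [this]
    exact ReducesTo.refl.outContract v w hw
  · push Not at hw
    have : G.eliminate v = G.deleteVertex v := by
      ext x y
      refine ⟨fun h => h.2.resolve_right fun h => hw _ h.2, fun h => ⟨?_, .inl h⟩⟩
      exact fun e => hne h (congrArg Subtype.val e)
    rw [this]
    exact ReducesTo.refl.deleteVertex v

theorem eliminable_of_not_hasForbiddenMinor {V : Type u} [Finite V] {G : Digraph V}
    (hG : G.Loopless) (hno : ¬ G.HasForbiddenMinor) : G.Eliminable := by
  induction hn : Nat.card V using Nat.strong_induction_on generalizing V with
  | _ n ih =>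
    rcases isEmpty_or_nonempty V with hV | hV
    · exact .empty G
    have hmin : ¬ G.MinOutTwo := fun h => hno h.hasForbiddenMinor
    unfold MinOutTwo at hmin
    push Not at hmin
    obtain ⟨v, hv⟩ := hmin
    have hne : ∀ {y}, G.Adj v y → v ≠ y := by
      rintro _ h rfl
      exact hG v h
    have hout : ∀ w w', G.Adj v w → G.Adj v w' → w = w' := by
      intro w w' hw hw'
      by_contra hww
      exact hv w w' (hne hw) (hne hw') hww hw hw'
    refine .step G v hG hout (ih _ (hn ▸ Finite.card_subtype_lt (x := v) (by simp))
      (fun x h => h.1 rfl) (fun h => hno (.of_reducesTo (reducesTo_eliminate hG hout) h)) rfl)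

/-! ### From an elimination to a partial 1-DAG -/

theorem IsKDAG.of_equiv {k : ℕ} {V W : Type u} {G : Digraph V} {H : Digraph W} (h : IsKDAG k G)
    (e : V ≃ W) (he : ∀ x y, H.Adj (e x) (e y) ↔ G.Adj x y) : IsKDAG k H := by
  induction h generalizing W with
  | complete G hfin hcard hG =>
    refine .complete H (Finite.of_equiv _ e) (hcard ▸ (Nat.card_congr e).symm) fun x y => ?_
    rw [← e.apply_symm_apply x, ← e.apply_symm_apply y, he, hG, e.injective.ne_iff]
  | @extend V G v _ hloop hout hin ih =>
    have heq : {w | H.Adj (e v) w} = e '' {w | G.Adj v w} := by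
      ext w
      rw [← e.apply_symm_apply w, e.injective.mem_set_image]
      exact he _ _
    refine .extend H (e v) ?_ (by rwa [he]) ?_ ?_
    · exact ih (e.subtypeEquiv fun a => e.injective.ne_iff.symm) fun x y => he _ _
    · rwa [heq, Set.ncard_image_of_injective _ e.injective]
    · intro u hu
      obtain ⟨u, rfl⟩ := e.surjective u
      rw [he, hin u (e.injective.ne_iff.1 hu), e.forall_congr_left]
      refine forall_congr' fun w => ?_
      rw [← he, ← he, ← e.injective.ne_iff, e.apply_symm_apply]

/-- Extend the 1-DAG of the smaller digraph by a vertex for `v` with the same out-neighbour. The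
in-neighbours of `v` are allowed because elimination has joined them to that out-neighbour. -/
theorem Eliminable.isPartialKDAG {V : Type u} {G : Digraph V} (h : G.Eliminable) :
    G.IsPartialKDAG 1 := by
  induction h with
  | empty G =>
    -- A 1-DAG has at least one vertex, so the null digraph is placed in the one-vertex 1-DAG.
    exact ⟨PUnit, ⟨fun x y => x ≠ y⟩, .complete _ inferInstance (by simp) fun _ _ => Iff.rfl,
      isEmptyElim, fun x => isEmptyElim x, fun x => isEmptyElim x⟩
  | @step V G v hG hout _ ih =>
    obtain ⟨W, H, hH, f, hf, hadj⟩ := ih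
    let X : Set W := {w | ∃ y : {x // x ≠ v}, G.Adj v y ∧ f y = w}
    let K : Digraph (Option W) := ⟨fun x y => match x, y with
      | some x, some y => H.Adj x y
      | some x, none => ∀ w ∈ X, w ≠ x → H.Adj x w
      | none, some y => y ∈ X
      | none, none => False⟩
    have hfin := hH.finite
    refine ⟨Option W, K, .extend K none ?_ id ?_ ?_,
      fun x => open Classical in if hx : x = v then none else some (f ⟨x, hx⟩), ?_, ?_⟩
    · refine hH.of_equiv ⟨fun x => ⟨some x, by simp⟩, fun x => x.1.get
        (Option.isSome_iff_ne_none.2 x.2), fun x => by simp, fun x => by simp⟩ fun x y => Iff.rfl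
    · refine (Set.ncard_le_one (Set.toFinite _)).2 ?_
      rintro (_ | _) ha (_ | _) hb
      · rfl
      · exact ha.elim
      · exact hb.elim
      · obtain ⟨y, hy, rfl⟩ := ha
        obtain ⟨z, hz, rfl⟩ := hb
        rw [Subtype.ext (hout _ _ hy hz)]
    · rintro (_ | u) hu
      · exact absurd rfl hu
      · refine ⟨?_, fun h w hw hwu => h (some w) hw (by simpa using hwu)⟩
        rintro h (_ | w) hw hwu
        · exact hw.elim
        · exact h w hw (by simpa using hwu)
    · intro x y hxy
      by_cases hx : x = v <;> by_cases hy : y = v <;> simp only [hx, hy, dite_true, dite_false,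
        reduceCtorEq, Option.some.injEq] at hxy ⊢
      exact congrArg Subtype.val (hf hxy)
    · intro x y hxy
      have hne : x ≠ y := by
        rintro rfl
        exact hG x hxy
      by_cases hx : x = v <;> by_cases hy : y = v
      · exact absurd (hx.trans hy.symm) hne
      · subst hx
        simp only [dite_true, hy, dite_false]
        exact ⟨⟨y, hy⟩, hxy, rfl⟩
      · subst hy
        simp only [dite_true, hx, dite_false]
        rintro _ ⟨w, hw, rfl⟩ hwx
        refine hadj _ _ ⟨?_, .inr ⟨hxy, hw⟩⟩
        rintro rfl
        exact hwx rfl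
      · simp only [hx, hy, dite_false]
        exact hadj _ _ ⟨by simpa using hne, .inl hxy⟩

/-! ### From an elimination to a Kelly-decomposition of width at most 2 -/

theorem bagsFrom_mono {V : Type u} {N : Type} {T : Digraph N} {W : N → Set V} {i j : N}
    (h : Relation.ReflTransGen T.Adj i j) : bagsFrom T W j ⊆ bagsFrom T W i :=
  Set.biUnion_subset_biUnion_left fun _ hk => h.trans hk

theorem subset_bagsFrom {V : Type u} {N : Type} (T : Digraph N) (W : N → Set V) (i : N) :
    W i ⊆ bagsFrom T W i :=
  fun _ hx => Set.mem_biUnion (x := i) Relation.ReflTransGen.refl hx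

theorem KellyDecomposition.X_subset {V : Type u} {G : Digraph V} (D : KellyDecomposition G)
    {i j : D.N} (h : Relation.ReflTransGen D.T.Adj i j) :
    D.X j ⊆ bagsFrom D.T D.W i ∪ D.X i := by
  induction h with
  | refl => exact Set.subset_union_right
  | @tail j k hij hjk ih =>
    intro x hx
    obtain ⟨s, c, -, hrange, hc⟩ := D.children j
    obtain ⟨q, rfl⟩ : k ∈ Set.range c := hrange ▸ hjk
    rcases hc q hx with (h | h) | h
    · exact .inl (bagsFrom_mono hij (subset_bagsFrom _ _ _ h))
    · exact ih h
    · obtain ⟨p, -, hp⟩ := Set.mem_iUnion₂.1 h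
      have hjp : D.T.Adj j (c p) := by
        have : c p ∈ Set.range c := ⟨p, rfl⟩
        rwa [hrange] at this
      exact .inl (bagsFrom_mono (hij.tail hjp) hp)

section AddVertex

variable {V : Type u} {G : Digraph V} {v : V} (D : KellyDecomposition (G.eliminate v))

/-- Add a node for `v` below all the nodes whose bags contain the out-neighbours of `v`. -/
def addNodeDAG : Digraph (Option D.N) where
  Adj
    | some i, some j => D.T.Adj i j
    | some i, none => ∀ w : {x // x ≠ v}, G.Adj v w → w ∈ D.W i ∪ D.X i
    | none, _ => False

/-- The partition bags after adding a node for `v`. -/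
def addNodeW : Option D.N → Set V
  | some i => Subtype.val '' D.W i
  | none => {v}

/-- The guarding bags after adding a node for `v`. -/
def addNodeX : Option D.N → Set V
  | some i => Subtype.val '' D.X i
  | none => {w | G.Adj v w}

theorem reach_addNodeDAG {i : D.N} {t : Option D.N}
    (h : Relation.ReflTransGen (addNodeDAG D).Adj (some i) t) :
    (∀ j, t = some j → Relation.ReflTransGen D.T.Adj i j) ∧
      (t = none → ∃ j, Relation.ReflTransGen D.T.Adj i j ∧ (addNodeDAG D).Adj (some j) none) := by
  induction h with
  | refl =>
    refine ⟨?_, fun h => by simp at h⟩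
    rintro j ⟨⟩
    exact .refl
  | @tail a b _ hab ih =>
    rcases a with _ | a
    · exact hab.elim
    have ha := ih.1 a rfl
    refine ⟨?_, ?_⟩
    · rintro j rfl
      exact ha.tail hab
    · rintro rfl
      exact ⟨a, ha, hab⟩

theorem reach_addNodeDAG_some {i j : D.N} (h : Relation.ReflTransGen D.T.Adj i j) :
    Relation.ReflTransGen (addNodeDAG D).Adj (some i) (some j) :=
  h.lift some fun _ _ h => h

theorem transGen_addNodeDAG {i j : D.N}
    (h : Relation.TransGen (addNodeDAG D).Adj (some i) (some j)) :
    Relation.TransGen D.T.Adj i j := by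
  generalize ht : some j = t at h
  induction h generalizing j with
  | single h =>
    subst ht
    exact .single h
  | @tail a b _ hab ih =>
    subst ht
    rcases a with _ | a
    · exact hab.elim
    exact (ih rfl).tail hab

theorem mem_bagsFrom_addNode {i : D.N} {x : V} :
    x ∈ bagsFrom (addNodeDAG D) (addNodeW D) (some i) ↔
      x ∈ Subtype.val '' bagsFrom D.T D.W i ∨ (x = v ∧
        ∃ j, Relation.ReflTransGen D.T.Adj i j ∧ (addNodeDAG D).Adj (some j) none) := by
  constructor
  · intro hx
    obtain ⟨_ | j, hij, hxj⟩ := Set.mem_iUnion₂.1 hx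
    · exact .inr ⟨hxj, (reach_addNodeDAG D hij).2 rfl⟩
    · obtain ⟨x, hxj, rfl⟩ := hxj
      exact .inl ⟨x, Set.mem_biUnion (x := j) ((reach_addNodeDAG D hij).1 j rfl) hxj, rfl⟩
  · rintro (⟨x, hx, rfl⟩ | ⟨rfl, j, hij, hj⟩)
    · obtain ⟨j, hij, hxj⟩ := Set.mem_iUnion₂.1 hx
      exact Set.mem_biUnion (x := some j) (reach_addNodeDAG_some D hij) ⟨x, hxj, rfl⟩
    · exact Set.mem_biUnion (x := none) ((reach_addNodeDAG_some D hij).tail hj) rfl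

theorem bagsFrom_addNode_none : bagsFrom (addNodeDAG D) (addNodeW D) none = {v} := by
  refine Set.Subset.antisymm ?_ (subset_bagsFrom (addNodeDAG D) (addNodeW D) none)
  intro x hx
  obtain ⟨t, ht, hxt⟩ := Set.mem_iUnion₂.1 hx
  rcases Relation.ReflTransGen.cases_head ht with rfl | ⟨_, h, -⟩
  · exact hxt
  · exact h.elim

theorem image_bagsFrom_subset (i : D.N) :
    Subtype.val '' bagsFrom D.T D.W i ⊆ bagsFrom (addNodeDAG D) (addNodeW D) (some i) :=
  fun _ hx => (mem_bagsFrom_addNode D).2 (.inl hx)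

/-- If a vertex `a` of the bags below `i` points to `v`, the out-neighbour of `v` is `a` or a head
of an edge at `a` after elimination. It thus lies in a bag below `i` or in `X i`, which puts the new
node below `i`. Conversely, if the new node is below `i`, `X_subset` places the out-neighbour of `v`
in those bags or in `X i`. -/
theorem guards_addNode (hG : G.Loopless) (hout : ∀ w w', G.Adj v w → G.Adj v w' → w = w')
    (t : Option D.N) :
    G.Guards (addNodeX D t) (bagsFrom (addNodeDAG D) (addNodeW D) t) := by
  have hne : ∀ {x y}, G.Adj x y → x ≠ y := by
    rintro x _ h rfl
    exact hG x h
  rcases t with _ | i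
  · rw [bagsFrom_addNode_none]
    refine ⟨Set.disjoint_singleton_left.2 (hG v), ?_⟩
    rintro _ y hy rfl
    exact .inr hy
  obtain ⟨hdisj, hguard⟩ := D.guards i
  have hv : (∀ w : {x // x ≠ v}, G.Adj v w → w ∈ bagsFrom D.T D.W i ∪ D.X i) →
      v ∈ bagsFrom (addNodeDAG D) (addNodeW D) (some i) := by
    intro h
    refine (mem_bagsFrom_addNode D).2 (.inr ⟨rfl, ?_⟩)
    by_cases hw : ∃ w : {x // x ≠ v}, G.Adj v w
    · obtain ⟨w, hw⟩ := hw
      have huniq : ∀ w' : {x // x ≠ v}, G.Adj v w' → w' = w :=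
        fun w' hw' => Subtype.ext (hout _ _ hw' hw)
      rcases h w hw with h | h
      · obtain ⟨j, hij, hj⟩ := Set.mem_iUnion₂.1 h
        exact ⟨j, hij, fun w' hw' => huniq w' hw' ▸ .inl hj⟩
      · exact ⟨i, .refl, fun w' hw' => huniq w' hw' ▸ .inr h⟩
    · exact ⟨i, .refl, fun w hw' => absurd ⟨w, hw'⟩ hw⟩
  refine ⟨?_, ?_⟩
  · refine Set.disjoint_left.2 fun x hx hxX => ?_
    obtain ⟨x', hx', rfl⟩ := hxX
    rcases (mem_bagsFrom_addNode D).1 hx with ⟨y, hy, hyx⟩ | ⟨h, -⟩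
    · exact Set.disjoint_left.1 hdisj hy (Subtype.ext hyx ▸ hx')
    · exact x'.2 h
  · intro x y hxy hx
    rcases (mem_bagsFrom_addNode D).1 hx with ⟨a, ha, rfl⟩ | ⟨rfl, j, hij, hj⟩
    · by_cases hy : y = v
      · subst hy
        refine .inl (hv fun w hw => ?_)
        by_cases haw : a = w
        · exact .inl (haw ▸ ha)
        · exact hguard a w ⟨haw, .inr ⟨hxy, hw⟩⟩ ha
      · exact (hguard a ⟨y, hy⟩ ⟨fun h => hne hxy (congrArg Subtype.val h), .inl hxy⟩ ha).imp
          (fun h => image_bagsFrom_subset D i ⟨_, h, rfl⟩) fun h => ⟨_, h, rfl⟩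
    · have hy : (⟨y, (hne hxy).symm⟩ : {z // z ≠ x}) ∈ bagsFrom D.T D.W i ∪ D.X i := by
        rcases hj ⟨y, (hne hxy).symm⟩ hxy with h | h
        · exact .inl (bagsFrom_mono hij (subset_bagsFrom _ _ _ h))
        · exact D.X_subset hij h
      exact hy.imp (fun h => image_bagsFrom_subset D i ⟨_, h, rfl⟩) fun h => ⟨_, h, rfl⟩

theorem children_addNode (hG : G.Loopless) (t : Option D.N) : ∃ (s : ℕ) (j : Fin s → Option D.N),
    Function.Injective j ∧ Set.range j = {t' | (addNodeDAG D).Adj t t'} ∧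
    ∀ q, addNodeX D (j q) ⊆ addNodeW D t ∪ addNodeX D t ∪
      ⋃ p ∈ Set.Iio q, bagsFrom (addNodeDAG D) (addNodeW D) (j p) := by
  rcases t with _ | i
  · refine ⟨0, Fin.elim0, fun i => i.elim0, ?_, fun q => q.elim0⟩
    ext x
    simp [addNodeDAG]
  obtain ⟨s, j, hinj, hrange, hj⟩ := D.children i
  have hmem : ∀ k, D.T.Adj i k ↔ ∃ p, j p = k := fun k => (Set.ext_iff.1 hrange k).symm
  have hold : ∀ q, ∀ x ∈ addNodeX D (some (j q)),
      x ∈ addNodeW D (some i) ∪ addNodeX D (some i) ∨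
        ∃ p < q, x ∈ bagsFrom (addNodeDAG D) (addNodeW D) (some (j p)) := by
    rintro q _ ⟨x, hx, rfl⟩
    rcases hj q hx with (h | h) | h
    · exact .inl (.inl ⟨x, h, rfl⟩)
    · exact .inl (.inr ⟨x, h, rfl⟩)
    · obtain ⟨p, hp, h⟩ := Set.mem_iUnion₂.1 h
      exact .inr ⟨p, hp, image_bagsFrom_subset D _ ⟨x, h, rfl⟩⟩
  by_cases hnone : (addNodeDAG D).Adj (some i) none
  -- The new node can come first, since its guard lies in `W i ∪ X i`; this only enlarges the unions
  -- available to the other children.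
  · refine ⟨s + 1, Fin.cons none (some ∘ j), ?_, ?_, ?_⟩
    · refine Fin.cons_injective_iff.2 ⟨by simp, (Option.some_injective _).comp hinj⟩
    · ext (_ | k)
      · simpa using hnone
      · rw [Fin.range_cons]
        simpa [addNodeDAG] using (hmem k).symm
    · intro q x hx
      induction q using Fin.cases with
      | zero =>
        have hxv : x ≠ v := by
          rintro rfl
          exact hG x hx
        exact .inl ((hnone ⟨x, hxv⟩ hx).imp (fun h => ⟨_, h, rfl⟩) fun h => ⟨_, h, rfl⟩)
      | succ q =>
        refine (hold q x hx).imp id ?_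
        rintro ⟨p, hp, h⟩
        exact Set.mem_iUnion₂.2 ⟨p.succ, Fin.succ_lt_succ_iff.2 hp, h⟩
  · refine ⟨s, some ∘ j, (Option.some_injective _).comp hinj, ?_, ?_⟩
    · ext (_ | k)
      · simpa using hnone
      · simpa [addNodeDAG] using (hmem k).symm
    · intro q x hx
      refine (hold q x hx).imp id ?_
      rintro ⟨p, hp, h⟩
      exact Set.mem_iUnion₂.2 ⟨p, hp, h⟩

theorem roots_addNode (hG : G.Loopless) (hout : ∀ w w', G.Adj v w → G.Adj v w' → w = w') :
    ∃ (s : ℕ) (r : Fin s → Option D.N), Function.Injective r ∧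
      Set.range r = {t | ∀ i, ¬ (addNodeDAG D).Adj i t} ∧
      ∀ q, addNodeX D (r q) ⊆ ⋃ p ∈ Set.Iio q, bagsFrom (addNodeDAG D) (addNodeW D) (r p) := by
  by_cases hpar : ∃ i, (addNodeDAG D).Adj (some i) none
  · obtain ⟨s, r, hinj, hrange, hr⟩ := D.roots
    refine ⟨s, some ∘ r, (Option.some_injective _).comp hinj, ?_, ?_⟩
    · ext (_ | k)
      · obtain ⟨i, hi⟩ := hpar
        simpa using ⟨some i, hi⟩
      · have hk : (∃ p, r p = k) ↔ ∀ i, ¬ D.T.Adj i k := Set.ext_iff.1 hrange k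
        simp only [Set.mem_range, Function.comp_apply, Option.some.injEq, hk, Set.mem_ofPred_eq]
        refine ⟨?_, fun h i => h (some i)⟩
        rintro h (_ | i)
        · exact id
        · exact h i
    · rintro q _ ⟨x, hx, rfl⟩
      obtain ⟨p, hp, h⟩ := Set.mem_iUnion₂.1 (hr q hx)
      exact Set.mem_iUnion₂.2 ⟨p, hp, image_bagsFrom_subset D _ ⟨x, h, rfl⟩⟩
  -- The new node lacks a parent only if there are no old nodes: a bag containing the out-neighbour
  -- of `v` gives a parent, and if `v` has no out-neighbour, every old node is one.
  · have hno : ∀ w, ¬ G.Adj v w := by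
      intro w hw
      have hwv : w ≠ v := by
        rintro rfl
        exact hG w hw
      obtain ⟨i, hi, -⟩ := D.partition ⟨w, hwv⟩
      refine hpar ⟨i, fun w' hw' => .inl ?_⟩
      rwa [show w' = ⟨w, hwv⟩ from Subtype.ext (hout _ _ hw' hw)]
    have hempty : IsEmpty D.N := ⟨fun i => hpar ⟨i, fun w hw => absurd hw (hno w)⟩⟩
    refine ⟨1, fun _ => none, fun _ _ _ => Subsingleton.elim _ _, ?_,
      fun q x hx => absurd hx (hno x)⟩
    ext (_ | k)
    · simp only [Set.range_const, Set.mem_singleton_iff, Set.mem_ofPred_eq, true_iff]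
      rintro (_ | i)
      · exact id
      · exact isEmptyElim i
    · exact isEmptyElim k

/-- A Kelly-decomposition of `G` from one of the digraph that remains when the vertex `v` of
out-degree at most one is eliminated. -/
def addNode (hG : G.Loopless) (hout : ∀ w w', G.Adj v w → G.Adj v w' → w = w') :
    KellyDecomposition G where
  N := Option D.N
  fintype := let _ := D.fintype; inferInstance
  T := addNodeDAG D
  acyclic := by
    rintro (_ | i) h
    · obtain ⟨_, h, -⟩ := Relation.TransGen.head'_iff.1 h
      exact h
    · exact D.acyclic i (transGen_addNodeDAG D h)
  W := addNodeW D
  X := addNodeX D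
  nonempty := by
    rintro (_ | i)
    · exact Set.singleton_nonempty v
    · exact (D.nonempty i).image _
  partition := by
    intro x
    by_cases hx : x = v
    · subst hx
      refine ⟨none, rfl, ?_⟩
      rintro (_ | i) h
      · rfl
      · obtain ⟨y, -, hy⟩ := h
        exact absurd hy y.2
    · obtain ⟨i, hi, huniq⟩ := D.partition ⟨x, hx⟩
      refine ⟨some i, ⟨_, hi, rfl⟩, ?_⟩
      rintro (_ | j) h
      · exact absurd h hx
      · obtain ⟨y, hy, rfl⟩ := h
        rw [huniq j hy]
  guards := guards_addNode D hG hout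
  children := children_addNode D hG
  roots := roots_addNode D hG hout

theorem width_addNode_le [Finite V] (hG : G.Loopless)
    (hout : ∀ w w', G.Adj v w → G.Adj v w' → w = w') (hD : D.width ≤ 2) :
    (addNode D hG hout).width ≤ 2 := by
  refine Finset.sup_le ?_
  rintro (_ | i) -
  · refine (Set.ncard_union_le {v} {w | G.Adj v w}).trans ?_
    rw [Set.ncard_singleton]
    have : {w | G.Adj v w}.ncard ≤ 1 :=
      (Set.ncard_le_one (Set.toFinite _)).2 fun a ha b hb => hout a b ha hb
    omega
  · have h : (Subtype.val '' D.W i ∪ Subtype.val '' D.X i).ncard ≤ 2 := by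
      rw [← Set.image_union, Set.ncard_image_of_injective _ Subtype.val_injective]
      let _ := D.fintype
      exact (Finset.le_sup (f := fun i => (D.W i ∪ D.X i).ncard) (Finset.mem_univ i)).trans hD
    exact h

end AddVertex

theorem Eliminable.exists_width_le {V : Type u} {G : Digraph V} (h : G.Eliminable) (hV : Finite V) :
    ∃ D : KellyDecomposition G, D.width ≤ 2 := by
  induction h with
  | empty G =>
    obtain ⟨D⟩ := nonempty_kellyDecomposition G
    refine ⟨D, Finset.sup_le fun i _ => ?_⟩
    rw [Set.eq_empty_of_isEmpty (D.W i ∪ D.X i), Set.ncard_empty]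
    exact Nat.zero_le 2
  | step G v hG hout _ ih =>
    obtain ⟨D, hD⟩ := ih inferInstance
    exact ⟨addNode D hG hout, width_addNode_le D hG hout hD⟩

theorem kellyWidth_le_iff {V : Type u} {G : Digraph V} {n : ℕ} :
    G.kellyWidth ≤ n ↔ ∃ D : KellyDecomposition G, D.width ≤ n := by
  constructor
  · intro h
    obtain ⟨D₀⟩ := nonempty_kellyDecomposition G
    obtain ⟨D, hD⟩ := Nat.sInf_mem (s := Set.range (KellyDecomposition.width (G := G)))
      ⟨_, D₀, rfl⟩
    exact ⟨D, hD.trans_le h⟩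
  · rintro ⟨D, hD⟩
    exact (Nat.sInf_le (Set.mem_range_self D)).trans hD

end Digraph

theorem mainTheorem1 {V : Type u} [Finite V] (G : Digraph V) (hG : G.Loopless) :
    (G.kellyWidth ≤ 2 ↔ G.IsPartialKDAG 1) ∧
      (G.IsPartialKDAG 1 ↔
        ¬ Digraph.K3.IsDirectedMinor G ∧ ¬ Digraph.N4.IsDirectedMinor G ∧
          ¬ Digraph.M5.IsDirectedMinor G) := by
  have helim : G.LocallyNarrow → G.Eliminable := fun h =>
    Digraph.eliminable_of_not_hasForbiddenMinor hG h.not_hasForbiddenMinor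
  have hforb : ¬ G.HasForbiddenMinor ↔ ¬ Digraph.K3.IsDirectedMinor G ∧
      ¬ Digraph.N4.IsDirectedMinor G ∧ ¬ Digraph.M5.IsDirectedMinor G := by
    simp only [Digraph.HasForbiddenMinor, not_or]
  rw [← hforb, Digraph.kellyWidth_le_iff]
  exact ⟨⟨fun ⟨D, hD⟩ => (helim (D.locallyNarrow hD)).isPartialKDAG,
      fun h => (helim h.locallyNarrow).exists_width_le inferInstance⟩,
    fun h => h.locallyNarrow.not_hasForbiddenMinor,
    fun h => (Digraph.eliminable_of_not_hasForbiddenMinor hG h).isPartialKDAG⟩
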